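/- Let $P$ be an irreducible transition probability on a countably infinite set $S$. Write $\mathbb P^x$ for the law of the Markov chain $(X_n)_{n\ge 0}$ with transition probability $P$ and $X_0=x$, and put $\tau^y=\inf\{n\ge 1: X_n=y\}$. Let $$G(x,y|z)=\sum_{n\ge 0}\mathbb P^x(X_n=y)\,z^n,\qquad U(x,y|z)=\sum_{n\ge 0}\mathbb P^x(\tau^y=n)\,z^n .$$ The convergence radius of $G(x,y|\cdot)$ does not depend on $x,y\in S$; its reciprocal $\rho$ is the spectral radius of $P$. Let $r(U|x,x)$ be the convergence radius of $U(x,x|\cdot)$. $P$ is called rho-recurrent if $G(x,y|1/\rho)=\infty$ for all $x,y\in S$, and strictly rho-recurrent if it is rho-recurrent and it is not the case that $r(U|x,x)=1/\rho$ for every $x\in S$. For $L\subset S$ and $\kappa\in[0,1)$ let $P^L_\kappa$ be the transition probability with $P^L_\kappa(x,y)=\kappa 1_{\{x=y\}}+(1-\kappa)P(x,y)$ if $x\in L$ and $P^L_\kappa(x,y)=P(x,y)$ if $x\notin L$, and let $\rho^L_\kappa$ be its spectral radius. **Theorem 1.4.** Suppose that $\rho<1$, $S\setminus L\neq\varnothing$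 and $\kappa\in(0,1)$. (i) If $S\setminus L$ is finite, then $\rho^L_\kappa=\rho^S_\kappa$ if and only if $P$ is not strictly rho-recurrent. (ii) If $P$ is strictly rho-recurrent, then $\rho^L_\kappa<\rho^S_\kappa$. (iii) If $L$ is finite, then $\rho^L_\kappa<\rho^S_\kappa$. -/

import Mathlib

open MeasureTheory ProbabilityTheory
open scoped ENNReal

noncomputable section

/-- A transition probability (stochastic matrix) `P(x, y)`, `x, y ∈ S`, on a state space `S`. -/
structure TransitionProb (S : Type*) where
  /-- the one-step probability of going from `x` to `y` -/
  prob : S → S → ℝ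
  nonneg : ∀ x y, 0 ≤ prob x y
  hasSum_one : ∀ x, HasSum (prob x) 1

namespace TransitionProb

variable {S : Type*}

/-- The row `P(x, ·)` as a probability mass function. -/
def row (P : TransitionProb S) (x : S) : PMF S :=
  ⟨fun y => ENNReal.ofReal (P.prob x y), by
    have h := ENNReal.ofReal_tsum_of_nonneg (P.nonneg x) (P.hasSum_one x).summable
    rw [(P.hasSum_one x).tsum_eq, ENNReal.ofReal_one] at h
    rw [h]
    exact ENNReal.summable.hasSum⟩

open Classical in
/-- The `(L, κ)`-lazy version of `P`: for `x ∈ L` the row `P(x, y)` is replaced by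
`κ 1_{x = y} + (1 - κ) P(x, y)`, and for `x ∉ L` it is unchanged. -/
def lazy (P : TransitionProb S) (L : Set S) (κ : ℝ) (h0 : 0 ≤ κ) (h1 : κ < 1) :
    TransitionProb S where
  prob x y :=
    if x ∈ L then κ * (if y = x then 1 else 0) + (1 - κ) * P.prob x y else P.prob x y
  nonneg x y := by
    have h := P.nonneg x y
    have h' : 0 ≤ 1 - κ := by linarith
    split_ifs <;> positivity
  hasSum_one x := by
    by_cases hx : x ∈ L
    · simp only [hx, if_true]
      have h := ((hasSum_ite_eq x (1 : ℝ)).mul_left κ).add ((P.hasSum_one x).mul_left (1 - κ))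
      have e : κ * 1 + (1 - κ) * 1 = 1 := by ring
      rwa [e] at h
    · simpa only [hx, if_false] using P.hasSum_one x

section Chain

variable [Countable S] [MeasurableSpace S] [DiscreteMeasurableSpace S]

/-- The one-step Markov kernel `x ↦ P(x, ·)` on the countable discrete space `S`. -/
def kernel (P : TransitionProb S) : Kernel S S :=
  Kernel.ofFunOfCountable fun x => (P.row x).toMeasure

instance (P : TransitionProb S) : IsMarkovKernel P.kernel :=
  ⟨fun x => PMF.toMeasure.isProbabilityMeasure (P.row x)⟩

/-- The kernel giving the law of `X_{n+1}` given `X_0, …, X_n`: it depends on the current state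
`X_n` only, through `P(X_n, ·)`. -/
def stepKernel (P : TransitionProb S) (n : ℕ) :
    Kernel ((i : Finset.Iic n) → (fun _ : ℕ => S) i) S :=
  P.kernel.comap (fun h => h ⟨n, Finset.mem_Iic.2 le_rfl⟩) (measurable_pi_apply _)

instance (P : TransitionProb S) (n : ℕ) : IsMarkovKernel (P.stepKernel n) := by
  unfold stepKernel
  infer_instance

/-- The law `ℙ^x` on trajectories `ω = (X_0, X_1, …)` of the Markov chain with transition
probability `P` and initial value `X_0 = x`. -/
def chainLaw (P : TransitionProb S) (x : S) : Measure (ℕ → S) :=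
  Kernel.traj (X := fun _ : ℕ => S) P.stepKernel 0 (fun _ => x)

/-- `P` is irreducible: every state can be reached from every state. -/
def IsIrreducible (P : TransitionProb S) : Prop :=
  ∀ x y : S, ∃ n : ℕ, 0 < P.chainLaw x {ω | ω n = y}

/-- The return time `τ^y = inf {n ≥ 1 : X_n = y}`, with `inf ∅ = ∞`. -/
def returnTime (y : S) (ω : ℕ → S) : ℕ∞ :=
  ⨅ (n : ℕ) (_ : 1 ≤ n ∧ ω n = y), (n : ℕ∞)

/-- The Green function `G(x, y | z) = ∑ₙ ℙ^x(X_n = y) zⁿ` at a nonnegative `z`; it may be `∞`. -/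
def green (P : TransitionProb S) (x y : S) (z : ℝ≥0∞) : ℝ≥0∞ :=
  ∑' n : ℕ, P.chainLaw x {ω | ω n = y} * z ^ n

/-- The convergence radius of the power series `G(x, y | ·)`. -/
def greenRadius (P : TransitionProb S) (x y : S) : ℝ≥0∞ :=
  (FormalMultilinearSeries.ofScalars ℝ
    (fun n : ℕ => (P.chainLaw x).real {ω | ω n = y})).radius

/-- The convergence radius `r(U | x, y)` of the power series
`U(x, y | z) = ∑ₙ ℙ^x(τ^y = n) zⁿ`. -/
def returnRadius (P : TransitionProb S) (x y : S) : ℝ≥0∞ :=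
  (FormalMultilinearSeries.ofScalars ℝ
    (fun n : ℕ => (P.chainLaw x).real {ω | returnTime y ω = (n : ℕ∞)})).radius

/-- The spectral radius of `P`, the reciprocal of the convergence radius of `G(x, y | ·)`. For
irreducible `P` the latter does not depend on `x` and `y`, so the supremum is the common value. -/
def spectralRadius (P : TransitionProb S) : ℝ≥0∞ :=
  ⨆ (x : S) (y : S), (P.greenRadius x y)⁻¹

/-- `P` is rho-recurrent: `G(x, y | 1 / ρ) = ∞` for all `x, y`. -/
def IsRhoRecurrent (P : TransitionProb S) : Prop :=
  ∀ x y : S, P.green x y (P.spectralRadius)⁻¹ = ∞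

/-- `P` is strictly rho-recurrent: it is rho-recurrent, but it is not the case that
`r(U | x, x) = 1 / ρ` for all `x`. -/
def IsStrictlyRhoRecurrent (P : TransitionProb S) : Prop :=
  P.IsRhoRecurrent ∧ ¬ ∀ x : S, P.returnRadius x x = (P.spectralRadius)⁻¹

end Chain

end TransitionProb

end

noncomputable section

/-! For irreducible `P`, `ρ` is the least `θ` admitting a positive finite `f` with `P f ≤ θ f`
(`isSpecRad`, `exists_super`). Applied to the lazy chains, this gives `ρ^S_κ = κ + (1 - κ) ρ`, and
everything reduces to building such functions.

The tool is Hölder's inequality: if `P h ≤ α h` and `P f ≤ β f` at a point, then `h^(1-t) f^t` has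
the bound `α^(1-t) β^t` there. Mixing a little of `f` into `h` gains where `f` beats `ρ`, and costs
arbitrarily little where `h` has slack, provided `f` has some finite bound there. Outside `L` slack
is free, since `ρ < κ + (1 - κ) ρ` when `ρ < 1`. So `ρ^L_κ < ρ^S_κ` as soon as some `f` satisfies `P
f ≤ σ f` on `L` with `σ < ρ`, and `P f ≤ C f` everywhere (`spectralRadius_lazy_lt`).

For finite `L` such an `f` is a perturbed generating function of the first hitting time of a state
outside `L` (`exists_strict_super`). Strict rho-recurrence amounts to the existence of an `f` that
beats `ρ` off one point, equivalently off a finite set. If `U(b, b | z) < ∞` for some `z > 1/ρ`, the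
generating function at `z` of the hitting time of `b` is such an `f`. Conversely, such an `f` rules
out `U(a, a | 1/ρ) < 1`, since mixing would then push the eigenvalue below `ρ` everywhere; it also
makes `U(a, a | ·)` finite beyond `1/ρ` (`isStrictlyRhoRecurrent_of_super`). When `S \ L` is finite,
a strict inequality `ρ^L_κ < ρ^S_κ` produces such an `f` from the lazy chain. -/

/-- The operator `f ↦ ∑ y, q(·, y) f(y)` of a nonnegative matrix `q`. -/
def transOp {S : Type*} (q : S → S → ℝ≥0∞) (f : S → ℝ≥0∞) (x : S) : ℝ≥0∞ :=
  ∑' y, q x y * f y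

/-- The Neumann series `∑ₙ zⁿ qⁿ b`. -/
def neumann {S : Type*} (q : S → S → ℝ≥0∞) (z : ℝ≥0∞) (b : S → ℝ≥0∞) (x : S) : ℝ≥0∞ :=
  ∑' n : ℕ, z ^ n * (transOp q)^[n] b x

open Classical in
/-- The matrix `q` with the transitions into `a` removed. -/
def taboo {S : Type*} (q : S → S → ℝ≥0∞) (a x y : S) : ℝ≥0∞ := if y = a then 0 else q x y

/-- The weight of the paths from `x` that enter `a` for the first time (after time `0`)
at time `n + 1`. -/
def hit {S : Type*} (q : S → S → ℝ≥0∞) (a : S) (n : ℕ) : S → ℝ≥0∞ :=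
  (transOp (taboo q a))^[n] (fun x => q x a)

/-- The hitting weights summed with coefficients `c`. -/
def hitSum {S : Type*} (q : S → S → ℝ≥0∞) (a : S) (c : ℕ → ℝ≥0∞) (x : S) : ℝ≥0∞ :=
  ∑' n, c n * hit q a n x

open Classical in
/-- The sum of the hitting weights including time `0`: coefficient `c k` for a first visit to `a`
at time `k ≥ 0`. -/
def hitExt {S : Type*} (q : S → S → ℝ≥0∞) (a : S) (c : ℕ → ℝ≥0∞) (x : S) : ℝ≥0∞ :=
  if x = a then c 0 else hitSum q a (fun n => c (n + 1)) x

open Classical in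
/-- Every state can be reached from every state with positive weight. -/
def Irred {S : Type*} (q : S → S → ℝ≥0∞) : Prop :=
  ∀ x y, ∃ n, (transOp q)^[n] (Pi.single y 1) x ≠ 0

/-! ### Nonnegative matrices as operators; Neumann series. -/

section Operator

variable {S : Type*} {q : S → S → ℝ≥0∞}

lemma transOp_mono (q : S → S → ℝ≥0∞) : Monotone (transOp q) := fun _ _ h _ =>
  ENNReal.tsum_le_tsum fun y => mul_le_mul_right (h y) _

lemma transOp_const_mul (c : ℝ≥0∞) (f : S → ℝ≥0∞) :
    transOp q (fun x => c * f x) = fun x => c * transOp q f x := by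
  funext x
  simp only [transOp, ← ENNReal.tsum_mul_left]
  exact tsum_congr fun y => by ring

lemma transOp_add (f g : S → ℝ≥0∞) :
    transOp q (fun x => f x + g x) = fun x => transOp q f x + transOp q g x := by
  funext x
  simp only [transOp, mul_add, ENNReal.tsum_add]

lemma transOp_tsum {ι : Type*} (f : ι → S → ℝ≥0∞) :
    transOp q (fun x => ∑' i, f i x) = fun x => ∑' i, transOp q (f i) x := by
  funext x
  simp only [transOp, ← ENNReal.tsum_mul_left]
  exact ENNReal.tsum_comm

lemma iterate_mono (q : S → S → ℝ≥0∞) (n : ℕ) : Monotone (transOp q)^[n] :=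
  (transOp_mono q).iterate n

lemma iterate_const_mul (c : ℝ≥0∞) (f : S → ℝ≥0∞) (n : ℕ) :
    (transOp q)^[n] (fun x => c * f x) = fun x => c * (transOp q)^[n] f x := by
  induction n with
  | zero => rfl
  | succ n ih => rw [Function.iterate_succ_apply', ih, transOp_const_mul, Function.iterate_succ_apply']

lemma iterate_le_of_le {f : S → ℝ≥0∞} {θ : ℝ≥0∞} (h : ∀ x, transOp q f x ≤ θ * f x) (n : ℕ)
    (x : S) : (transOp q)^[n] f x ≤ θ ^ n * f x := by
  induction n generalizing x with
  | zero => simp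
  | succ n ih =>
    rw [Function.iterate_succ_apply']
    calc transOp q ((transOp q)^[n] f) x ≤ transOp q (fun x => θ ^ n * f x) x := transOp_mono q ih x
      _ = θ ^ n * transOp q f x := by rw [transOp_const_mul]
      _ ≤ θ ^ n * (θ * f x) := mul_le_mul_right (h x) _
      _ = θ ^ (n + 1) * f x := by ring

open Classical in
lemma iterate_single_mul_le (f : S → ℝ≥0∞) (n : ℕ) (x y : S) :
    (transOp q)^[n] (Pi.single y 1) x * f y ≤ (transOp q)^[n] f x := by
  have := iterate_const_mul (q := q) (f y) (Pi.single y 1) n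
  rw [mul_comm, ← congrFun this x]
  refine iterate_mono q n (fun w => ?_) x
  by_cases hw : w = y
  · subst hw; simp
  · simp [hw]

/-- A nonnegative function with `q f ≤ C f` that is positive and finite at one point is so
everywhere. -/
lemma pos_of_super (hq : Irred q) {f : S → ℝ≥0∞} {C : ℝ≥0∞} (hC : C ≠ ∞)
    (h : ∀ x, transOp q f x ≤ C * f x) {a : S} (ha : f a ≠ 0) (ha' : f a ≠ ∞) (x : S) :
    f x ≠ 0 ∧ f x ≠ ∞ := by
  constructor
  · obtain ⟨n, hn⟩ := hq x a
    intro h0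
    have := (iterate_single_mul_le f n x a).trans (iterate_le_of_le h n x)
    rw [h0, mul_zero, nonpos_iff_eq_zero] at this
    exact mul_ne_zero hn ha this
  · obtain ⟨n, hn⟩ := hq a x
    intro h0
    have := (iterate_single_mul_le f n a x).trans (iterate_le_of_le h n a)
    rw [h0, ENNReal.mul_top hn, top_le_iff] at this
    exact ENNReal.mul_ne_top (ENNReal.pow_ne_top hC) ha' this

lemma transOp_neumann (z : ℝ≥0∞) (b : S → ℝ≥0∞) :
    transOp q (neumann q z b) = fun x => ∑' n : ℕ, z ^ n * (transOp q)^[n + 1] b x := by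
  unfold neumann
  rw [transOp_tsum]
  funext x
  refine tsum_congr fun n => ?_
  rw [transOp_const_mul, Function.iterate_succ_apply']

lemma neumann_eq (z : ℝ≥0∞) (b : S → ℝ≥0∞) (x : S) :
    neumann q z b x = b x + z * transOp q (neumann q z b) x := by
  rw [transOp_neumann, neumann, tsum_eq_zero_add' ENNReal.summable, ← ENNReal.tsum_mul_left]
  simp only [pow_zero, one_mul, Function.iterate_zero, id]
  congr 1
  exact tsum_congr fun n => by ring

lemma transOp_sum_range (f : ℕ → S → ℝ≥0∞) (N : ℕ) :
    transOp q (fun x => ∑ k ∈ Finset.range N, f k x) =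
      fun x => ∑ k ∈ Finset.range N, transOp q (f k) x := by
  induction N with
  | zero => funext x; simp [transOp]
  | succ N ih =>
    simp only [Finset.sum_range_succ]
    rw [transOp_add, ih]

/-- The Neumann series is the minimal supersolution of `X = b + z q X`. -/
lemma neumann_le {z : ℝ≥0∞} {b X : S → ℝ≥0∞} (h : ∀ x, b x + z * transOp q X x ≤ X x) (x : S) :
    neumann q z b x ≤ X x := by
  refine ENNReal.tsum_le_of_sum_range_le fun N => ?_
  induction N generalizing x with
  | zero => simp
  | succ N ih =>
    have hle : (fun x => ∑ k ∈ Finset.range N, z ^ k * (transOp q)^[k] b x) ≤ X := ih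
    have hT := transOp_mono q hle x
    rw [transOp_sum_range] at hT
    refine le_trans (le_of_eq ?_) ((add_le_add_right (mul_le_mul_right hT z) (b x)).trans (h x))
    rw [Finset.sum_range_succ', Finset.mul_sum, add_comm]
    congr 1
    · simp
    · refine Finset.sum_congr rfl fun k _ => ?_
      rw [transOp_const_mul, Function.iterate_succ_apply']
      ring

/-! ### First-passage decomposition and renewal. -/

lemma transOp_eq_taboo (a : S) (f : S → ℝ≥0∞) (x : S) :
    transOp q f x = q x a * f a + transOp (taboo q a) f x := by
  classical
  unfold transOp taboo
  rw [ENNReal.tsum_eq_add_tsum_ite a]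
  congr 1
  refine tsum_congr fun y => ?_
  split_ifs <;> simp

lemma transOp_taboo_congr {a : S} {f g : S → ℝ≥0∞} (h : ∀ y, y ≠ a → f y = g y) :
    transOp (taboo q a) f = transOp (taboo q a) g := by
  funext x
  refine tsum_congr fun y => ?_
  by_cases hy : y = a
  · simp [taboo, hy]
  · rw [h y hy]

lemma hit_succ (a : S) (n : ℕ) : hit q a (n + 1) = transOp (taboo q a) (hit q a n) :=
  Function.iterate_succ_apply' ..

/-- A step landing in `a` is a first visit with coefficient `c 0`; otherwise the remaining hitting
time is shifted by one. Growth of `c` thus controls how superharmonic `hitExt` is. -/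
lemma transOp_hitExt (a : S) (c : ℕ → ℝ≥0∞) : transOp q (hitExt q a c) = hitSum q a c := by
  funext x
  rw [transOp_eq_taboo a, transOp_taboo_congr (g := hitSum q a (fun n => c (n + 1)))
    (fun y hy => by simp [hitExt, hy])]
  unfold hitSum
  rw [transOp_tsum, tsum_eq_zero_add' ENNReal.summable]
  congr 1
  · rw [mul_comm]; simp [hitExt, hit]
  · exact tsum_congr fun n => by rw [transOp_const_mul, hit_succ]

lemma hitExt_pow_of_ne {a x : S} (z : ℝ≥0∞) (hx : x ≠ a) :
    hitExt q a (fun n => z ^ n) x = z * hitSum q a (fun n => z ^ n) x := by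
  simp only [hitExt, hx, if_false, hitSum, ← ENNReal.tsum_mul_left]
  exact tsum_congr fun n => by ring

lemma hitExt_pow_self (a : S) (z : ℝ≥0∞) : hitExt q a (fun n => z ^ n) a = 1 := by
  simp [hitExt]

/-- If `z q f ≤ f` off `a`, then the hitting series of `a` is dominated by `q f`. -/
lemma mul_hitSum_le {a : S} {z : ℝ≥0∞} {f : S → ℝ≥0∞}
    (h : ∀ x, x ≠ a → z * transOp q f x ≤ f x) (x : S) :
    f a * hitSum q a (fun n => z ^ n) x ≤ transOp q f x := by
  -- Splitting off the jump to `a` shows that `q f` is a supersolution of the taboo recursion with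
  -- source `f(a) q(·, a)`; the Neumann series is the minimal one.
  have key : neumann (taboo q a) z (fun x => f a * q x a) x ≤ transOp q f x := by
    refine neumann_le (fun x => ?_) x
    rw [transOp_eq_taboo (q := q) a f x, mul_comm (f a)]
    gcongr
    rw [← congrFun (transOp_const_mul (q := taboo q a) z (transOp q f)) x]
    refine ENNReal.tsum_le_tsum fun y => ?_
    by_cases hy : y = a
    · simp [taboo, hy]
    · exact mul_le_mul_right (h y hy) _
  refine le_trans (le_of_eq ?_) key
  unfold hitSum neumann hit
  rw [← ENNReal.tsum_mul_left]
  refine tsum_congr fun n => ?_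
  rw [iterate_const_mul]
  ring

open Classical in
/-- Renewal inequality `1 + U(a, a | z) G(a, a | z) ≤ G(a, a | z)`. -/
lemma one_add_mul_hitSum_le_green (a : S) (z : ℝ≥0∞) :
    1 + z * hitSum q a (fun n => z ^ n) a * neumann q z (Pi.single a 1) a
      ≤ neumann q z (Pi.single a 1) a := by
  have h := mul_hitSum_le (q := q) (a := a) (z := z) (f := neumann q z (Pi.single a 1))
    (fun x _ => by
      conv_rhs => rw [neumann_eq]
      exact le_add_self) a
  conv_rhs => rw [neumann_eq]
  rw [Pi.single_eq_same, mul_assoc, mul_comm (hitSum _ _ _ _)]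
  gcongr

-- `U ≥ 1` in the renewal inequality would give `1 + G ≤ G`, impossible for finite `G`.
open Classical in
lemma mul_hitSum_lt_one_of_green_ne_top {a : S} {z : ℝ≥0∞}
    (h : neumann q z (Pi.single a 1) a ≠ ∞) : z * hitSum q a (fun n => z ^ n) a < 1 := by
  by_contra! h1
  have := one_add_mul_hitSum_le_green (q := q) a z
  have h2 : 1 + neumann q z (Pi.single a 1) a ≤ neumann q z (Pi.single a 1) a :=
    le_trans (by gcongr; exact le_mul_of_one_le_left zero_le h1) this
  rw [add_comm] at h2
  exact absurd h2 (not_le.2 (ENNReal.lt_add_right h one_ne_zero))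

/-! ### Geometric means of superharmonic functions. -/

/-- Hölder's inequality for the operator `transOp`. -/
lemma transOp_geomMean_le (h f : S → ℝ≥0∞) {t : ℝ} (ht0 : 0 ≤ t) (ht1 : t ≤ 1) (x : S) :
    transOp q (fun y => h y ^ (1 - t) * f y ^ t) x ≤
      transOp q h x ^ (1 - t) * transOp q f x ^ t := by
  -- With the discrete σ-algebra and counting measure, sums over `S` become integrals with no
  -- measurability conditions.
  let _ : MeasurableSpace S := ⊤
  have key := ENNReal.lintegral_mul_norm_pow_le (μ := (Measure.count : Measure S))
    (f := fun y => q x y * h y) (g := fun y => q x y * f y)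
    measurable_from_top.aemeasurable measurable_from_top.aemeasurable
    (sub_nonneg.2 ht1) ht0 (by ring)
  simp only [lintegral_count' measurable_from_top] at key
  refine le_trans (le_of_eq ?_) key
  refine tsum_congr fun y => ?_
  rw [ENNReal.mul_rpow_of_nonneg _ _ (sub_nonneg.2 ht1), ENNReal.mul_rpow_of_nonneg _ _ ht0]
  have : q x y ^ (1 - t) * q x y ^ t = q x y := by
    rw [← ENNReal.rpow_add_of_nonneg _ _ (sub_nonneg.2 ht1) ht0]; simp
  calc q x y * (h y ^ (1 - t) * f y ^ t)
      = (q x y ^ (1 - t) * q x y ^ t) * (h y ^ (1 - t) * f y ^ t) := by rw [this]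
    _ = _ := by ring

lemma transOp_geomMean_le_of_le {h f : S → ℝ≥0∞} {α β : ℝ≥0∞} {t : ℝ} (ht0 : 0 ≤ t) (ht1 : t ≤ 1)
    {x : S} (hh : transOp q h x ≤ α * h x) (hf : transOp q f x ≤ β * f x) :
    transOp q (fun y => h y ^ (1 - t) * f y ^ t) x ≤
      (α ^ (1 - t) * β ^ t) * (h x ^ (1 - t) * f x ^ t) := by
  refine (transOp_geomMean_le h f ht0 ht1 x).trans ?_
  have h1 := ENNReal.rpow_le_rpow hh (sub_nonneg.2 ht1)
  have h2 := ENNReal.rpow_le_rpow hf ht0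
  rw [ENNReal.mul_rpow_of_nonneg _ _ (sub_nonneg.2 ht1)] at h1
  rw [ENNReal.mul_rpow_of_nonneg _ _ ht0] at h2
  refine (mul_le_mul' h1 h2).trans (le_of_eq (by ring))

end Operator

open Classical in
/-- `ρ` is the spectral radius of `q`: no positive finite function is `θ`-superharmonic for
`θ < ρ`, and the Green functions are finite below `1 / ρ`. -/
structure IsSpecRad {S : Type*} (q : S → S → ℝ≥0∞) (ρ : ℝ≥0∞) : Prop where
  le_of_super : ∀ (θ : ℝ≥0∞) (f : S → ℝ≥0∞), (∀ x, f x ≠ 0 ∧ f x ≠ ∞) →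
    (∀ x, transOp q f x ≤ θ * f x) → ρ ≤ θ
  green_ne_top : ∀ (z : ℝ≥0∞), z < ρ⁻¹ → ∀ a, neumann q z (Pi.single a 1) a ≠ ∞

/-! ### Superharmonic functions and the spectral radius. -/

section Spec

open Filter Topology

variable {S : Type*} {q : S → S → ℝ≥0∞} {ρ : ℝ≥0∞}

/-- Interpolating between a strict bound `α < γ` and a finite bound `β` keeps the bound `γ`. -/
lemma eventually_geomMean_lt {α β γ : ℝ≥0∞} (h : α < γ) (hβ : β ≠ ∞) :
    ∀ᶠ t : ℝ in 𝓝[>] 0, α ^ (1 - t) * β ^ t < γ := by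
  -- Replacing `α` by `α'` and `β` by `max β 1` makes both bases finite and nonzero, so the powers
  -- are continuous at `t = 0`.
  obtain ⟨α', h1, h2⟩ := ENNReal.lt_iff_exists_nnreal_btwn.1 h
  have hα' : α' ≠ 0 := by rintro rfl; simp at h1
  lift β to NNReal using hβ
  have hb : (max β 1) ≠ 0 := (lt_of_lt_of_le one_pos (le_max_right β 1)).ne'
  have hcont : Tendsto (fun t : ℝ => ((α' ^ (1 - t) * (max β 1) ^ t : NNReal) : ℝ≥0∞)) (𝓝[>] 0)
      (𝓝 ((α' ^ (1 - (0:ℝ)) * (max β 1) ^ (0:ℝ) : NNReal) : ℝ≥0∞)) := by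
    refine ENNReal.tendsto_coe.2 (Tendsto.mono_left ?_ nhdsWithin_le_nhds)
    refine Tendsto.mul ?_ ?_
    · exact tendsto_const_nhds.nnrpow (tendsto_const_nhds.sub tendsto_id) (Or.inl hα')
    · exact tendsto_const_nhds.nnrpow tendsto_id (Or.inl hb)
  have h3 : ((α' ^ (1 - (0:ℝ)) * (max β 1) ^ (0:ℝ) : NNReal) : ℝ≥0∞) < γ := by simpa using h2
  filter_upwards [hcont.eventually_lt_const h3, Ioo_mem_nhdsGT (zero_lt_one (α := ℝ))] with t ht ht1
  refine lt_of_le_of_lt ?_ ht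
  rw [ENNReal.coe_mul, ENNReal.coe_rpow_of_ne_zero hα', ENNReal.coe_rpow_of_ne_zero hb]
  refine mul_le_mul' (ENNReal.rpow_le_rpow h1.le (by linarith [ht1.2]))
    (ENNReal.rpow_le_rpow (by simp) ht1.1.le)

/-- Interpolating between a weak bound `α ≤ γ` and a strict bound `β < γ` gives a strict bound. -/
lemma geomMean_lt {α β γ : ℝ≥0∞} (hγ : γ ≠ ∞) (h : α ≤ γ) (hβ : β < γ) {t : ℝ} (ht0 : 0 < t)
    (ht1 : t ≤ 1) : α ^ (1 - t) * β ^ t < γ := by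
  have hγ0 : γ ≠ 0 := (pos_of_gt hβ).ne'
  calc α ^ (1 - t) * β ^ t ≤ γ ^ (1 - t) * β ^ t := by
        gcongr
    _ < γ ^ (1 - t) * γ ^ t := by
        refine (ENNReal.mul_lt_mul_iff_right ?_ ?_).2 (ENNReal.rpow_lt_rpow hβ ht0)
        · simp [ENNReal.rpow_eq_zero_iff, hγ0, hγ]
        · simp [ENNReal.rpow_eq_top_iff, hγ0, hγ]
    _ = γ := by rw [← ENNReal.rpow_add _ _ hγ0 hγ]; simp

lemma geomMean_ne {u v : ℝ≥0∞} (hu : u ≠ 0 ∧ u ≠ ∞) (hv : v ≠ 0 ∧ v ≠ ∞) (t : ℝ) :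
    u ^ (1 - t) * v ^ t ≠ 0 ∧ u ^ (1 - t) * v ^ t ≠ ∞ := by
  constructor
  · exact mul_ne_zero (by simp [ENNReal.rpow_eq_zero_iff, hu]) (by simp [ENNReal.rpow_eq_zero_iff, hv])
  · exact ENNReal.mul_ne_top (by simp [ENNReal.rpow_eq_top_iff, hu])
      (by simp [ENNReal.rpow_eq_top_iff, hv])

namespace IsSpecRad

lemma mul_hitSum_lt_one (hρ : IsSpecRad q ρ) {z : ℝ≥0∞} (hz : z < ρ⁻¹) (a : S) :
    z * hitSum q a (fun n => z ^ n) a < 1 :=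
  mul_hitSum_lt_one_of_green_ne_top (hρ.green_ne_top z hz a)

lemma transOp_hitExt_le {a : S} {z : ℝ≥0∞} (hz : z * hitSum q a (fun n => z ^ n) a ≤ 1)
    (x : S) : z * transOp q (hitExt q a (fun n => z ^ n)) x ≤ hitExt q a (fun n => z ^ n) x := by
  rw [transOp_hitExt]
  by_cases hx : x = a
  · subst hx; rwa [hitExt_pow_self]
  · rw [hitExt_pow_of_ne z hx]

/-- If `ρ = 0`, hitting functions are `1/z`-superharmonic for every finite `z ≥ 1`, so the weight of
a loop of positive length at `a` is at most `1/z`, hence zero, against irreducibility. -/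
lemma ne_zero [Nontrivial S] (hρ : IsSpecRad q ρ) (hq : Irred q) : ρ ≠ 0 := by
  classical
  rintro rfl
  obtain ⟨a, b, hab⟩ := exists_pair_ne S
  obtain ⟨n, hn⟩ := hq a b
  obtain ⟨m, hm⟩ := hq b a
  have hn0 : n ≠ 0 := by
    rintro rfl
    simp [hab] at hn
  have hc : (transOp q)^[n + m] (Pi.single a 1) a ≠ 0 := by
    rw [Function.iterate_add_apply]
    refine fun h => mul_ne_zero hn hm (le_antisymm ?_ zero_le)
    exact (iterate_single_mul_le _ n a b).trans h.le
  have hall : ∀ z : NNReal, 1 ≤ z → (z : ℝ≥0∞) * (transOp q)^[n + m] (Pi.single a 1) a ≤ 1 := by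
    intro z hz
    have hz0 : (z : ℝ≥0∞) ≠ 0 := by
      simpa using (lt_of_lt_of_le one_pos hz).ne'
    have h1 := transOp_hitExt_le (hρ.mul_hitSum_lt_one (z := z) (by simp) a).le
    have h2 : ∀ x, transOp q (hitExt q a (fun n => (z : ℝ≥0∞) ^ n)) x ≤
        (z : ℝ≥0∞)⁻¹ * hitExt q a (fun n => (z : ℝ≥0∞) ^ n) x := fun x => by
      rw [← ENNReal.div_eq_inv_mul, ENNReal.le_div_iff_mul_le (by simp [hz0]) (by simp), mul_comm]
      exact h1 x
    have h3 := (iterate_single_mul_le _ (n + m) a a).trans (iterate_le_of_le h2 (n + m) a)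
    rw [hitExt_pow_self, mul_one, mul_one, ENNReal.inv_pow.symm] at h3
    have h4 : (z : ℝ≥0∞) ≤ z ^ (n + m) :=
      le_self_pow₀ (by exact_mod_cast hz) (by omega)
    calc _ ≤ (z : ℝ≥0∞) ^ (n + m) * ((z : ℝ≥0∞) ^ (n + m))⁻¹ := mul_le_mul' h4 h3
      _ ≤ 1 := ENNReal.mul_inv_le_one _
  refine absurd (hall (max 1 (2 * ((transOp q)^[n + m] (Pi.single a 1) a)⁻¹.toNNReal))
    (le_max_left _ _)) (not_le.2 ?_)
  set c := (transOp q)^[n + m] (Pi.single a 1) a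
  by_cases hct : c = ∞
  · rw [hct, ENNReal.mul_top]
    · simp
    · exact_mod_cast (lt_of_lt_of_le one_pos (le_max_left _ _)).ne'
  calc (1 : ℝ≥0∞) < 2 := by norm_num
    _ = 2 * c⁻¹ * c := by rw [mul_assoc, ENNReal.inv_mul_cancel hc hct, mul_one]
    _ = ((2 * c⁻¹.toNNReal : NNReal) : ℝ≥0∞) * c := by
        rw [ENNReal.coe_mul, ENNReal.coe_toNNReal (by simpa using hc)]; rfl
    _ ≤ _ := by gcongr; exact le_max_right _ _

/-- `U(a, a | 1 / ρ) ≤ 1`. -/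
lemma inv_mul_hitSum_le_one (hρ : IsSpecRad q ρ) (h0 : ρ ≠ 0) (h1 : ρ ≠ ∞) (a : S) :
    ρ⁻¹ * hitSum q a (fun n => ρ⁻¹ ^ n) a ≤ 1 := by
  have hR0 : ρ⁻¹ ≠ 0 := by simpa using h1
  have hR1 : ρ⁻¹ ≠ ∞ := by simpa using h0
  unfold hitSum
  rw [← ENNReal.tsum_mul_left]
  refine ENNReal.tsum_le_of_sum_range_le fun N => ?_
  -- The bound is known only for `z < 1/ρ`; finite partial sums are continuous and carry it to the
  -- endpoint.
  have hcont : Tendsto (fun z : ℝ≥0∞ => ∑ k ∈ Finset.range N, z ^ (k + 1) * hit q a k a)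
      (𝓝[<] ρ⁻¹) (𝓝 (∑ k ∈ Finset.range N, ρ⁻¹ ^ (k + 1) * hit q a k a)) := by
    refine tendsto_finsetSum _ fun k _ => ?_
    refine ENNReal.Tendsto.mul_const ?_ (Or.inl (pow_ne_zero _ hR0))
    exact ((ENNReal.continuous_pow (k + 1)).tendsto _).mono_left nhdsWithin_le_nhds
  have hne : (𝓝[<] ρ⁻¹).NeBot := by
    refine nhdsLT_neBot_of_exists_lt ⟨0, hR0.bot_lt⟩
  have := le_of_tendsto (b := (1 : ℝ≥0∞)) hcont (by
    filter_upwards [self_mem_nhdsWithin] with z hz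
    refine le_trans ?_ (hρ.mul_hitSum_lt_one hz a).le
    unfold hitSum
    rw [← ENNReal.tsum_mul_left]
    refine le_trans (le_of_eq ?_) (ENNReal.sum_le_tsum (Finset.range N))
    exact Finset.sum_congr rfl fun k _ => by ring)
  refine le_trans (le_of_eq ?_) this
  exact Finset.sum_congr rfl fun k _ => by ring

lemma transOp_hitExt_inv_le (hρ : IsSpecRad q ρ) (h0 : ρ ≠ 0) (h1 : ρ ≠ ∞) (a x : S) :
    transOp q (hitExt q a (fun n => ρ⁻¹ ^ n)) x ≤ ρ * hitExt q a (fun n => ρ⁻¹ ^ n) x := by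
  have := transOp_hitExt_le (hρ.inv_mul_hitSum_le_one h0 h1 a) x
  rwa [mul_comm, ← div_eq_mul_inv, ENNReal.div_le_iff h0 h1, mul_comm] at this

lemma hitExt_inv_ne (hρ : IsSpecRad q ρ) (hq : Irred q) (h0 : ρ ≠ 0) (h1 : ρ ≠ ∞) (a x : S) :
    hitExt q a (fun n => ρ⁻¹ ^ n) x ≠ 0 ∧ hitExt q a (fun n => ρ⁻¹ ^ n) x ≠ ∞ :=
  pos_of_super hq h1 (hρ.transOp_hitExt_inv_le h0 h1 a) (a := a) (by simp [hitExt])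
    (by simp [hitExt]) x

/-- There is a positive `ρ`-superharmonic function. -/
lemma exists_super [Nontrivial S] (hρ : IsSpecRad q ρ) (hq : Irred q) (h1 : ρ ≠ ∞) :
    ∃ h : S → ℝ≥0∞, (∀ x, h x ≠ 0 ∧ h x ≠ ∞) ∧ ∀ x, transOp q h x ≤ ρ * h x := by
  obtain ⟨a⟩ : Nonempty S := inferInstance
  have h0 := hρ.ne_zero hq
  exact ⟨_, hρ.hitExt_inv_ne hq h0 h1 a, hρ.transOp_hitExt_inv_le h0 h1 a⟩

/-- There is a positive function that is strictly `ρ`-superharmonic off a given point. -/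
lemma exists_strict_super [Nontrivial S] (hρ : IsSpecRad q ρ) (hq : Irred q) (h1 : ρ ≠ ∞) (a : S) :
    ∃ f : S → ℝ≥0∞, (∀ x, f x ≠ 0 ∧ f x ≠ ∞) ∧ (∀ x, x ≠ a → transOp q f x < ρ * f x) ∧
      ∀ x, transOp q f x ≤ 2 * ρ * f x := by
  have h0 := hρ.ne_zero hq
  have hR0 : ρ⁻¹ ≠ 0 := by simpa using h1
  have hR1 : ρ⁻¹ ≠ ∞ := by simpa using h0
  set h := hitExt q a (fun n => ρ⁻¹ ^ n) with hh
  have hne := hρ.hitExt_inv_ne hq h0 h1 a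
  -- Strictly increasing weights in `[1, 2]`: since `P f` carries `w n` where `ρ f` carries `w (n +
  -- 1)`, monotonicity gives strictness off `a`, and boundedness keeps `f` comparable to `h`.
  set w : ℕ → ℝ≥0∞ := fun n => ∑ i ∈ Finset.range (n + 1), 2⁻¹ ^ i with hw
  have hw0 : w 0 = 1 := by simp [hw]
  have hw2 : ∀ n, w n ≤ 2 := fun n =>
    (ENNReal.sum_le_tsum _).trans ENNReal.tsum_geometric_two.le
  have hw1 : ∀ n, 1 ≤ w n := fun n => by
    rw [← hw0]
    exact Finset.sum_le_sum_of_subset (by simp)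
  have hwlt : ∀ n, w n < w (n + 1) := fun n => by
    have e : w (n + 1) = w n + 2⁻¹ ^ (n + 1) := Finset.sum_range_succ _ _
    rw [e]
    exact ENNReal.lt_add_right ((hw2 n).trans_lt (by simp)).ne (pow_ne_zero _ (by simp))
  set c : ℕ → ℝ≥0∞ := fun n => w n * ρ⁻¹ ^ n with hc
  have hle : ∀ x, hitExt q a c x ≤ 2 * h x := fun x => by
    simp only [hh, hitExt]
    split_ifs with hx
    · simpa [hc] using hw2 0
    · unfold hitSum
      rw [← ENNReal.tsum_mul_left]
      refine ENNReal.tsum_le_tsum fun n => ?_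
      rw [← mul_assoc]
      exact mul_le_mul_left (mul_le_mul_left (hw2 _) _) _
  have hge : ∀ x, h x ≤ hitExt q a c x := fun x => by
    simp only [hh, hitExt]
    split_ifs with hx
    · simpa [hc] using hw1 0
    · unfold hitSum
      refine ENNReal.tsum_le_tsum fun n => ?_
      gcongr
      exact le_mul_of_one_le_left zero_le (hw1 _)
  have hpos : ∀ x, hitExt q a c x ≠ 0 ∧ hitExt q a c x ≠ ∞ := fun x =>
    ⟨fun h' => (hne x).1 (le_antisymm (h' ▸ hge x) zero_le),
      ne_top_of_le_ne_top (ENNReal.mul_ne_top (by simp) (hne x).2) (hle x)⟩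
  refine ⟨hitExt q a c, hpos, fun x hx => ?_, fun x => ?_⟩
  · have e : ρ * hitExt q a c x = ∑' n, w (n + 1) * ρ⁻¹ ^ n * hit q a n x := by
      simp only [hitExt, hx, if_false, hitSum, ← ENNReal.tsum_mul_left]
      refine tsum_congr fun n => ?_
      simp only [hc, pow_succ]
      calc _ = (ρ * ρ⁻¹) * (w (n + 1) * ρ⁻¹ ^ n * hit q a n x) := by ring
        _ = _ := by rw [ENNReal.mul_inv_cancel h0 h1, one_mul]
    have hfin : ρ * hitExt q a c x ≠ ∞ := ENNReal.mul_ne_top h1 (hpos x).2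
    rw [transOp_hitExt, e]
    rw [e] at hfin
    have hterm : ∀ n, c n * hit q a n x ≤ w (n + 1) * ρ⁻¹ ^ n * hit q a n x := fun n => by
      simp only [hc]
      gcongr
      exact (hwlt n).le
    obtain ⟨n, hn⟩ : ∃ n, hit q a n x ≠ 0 := by
      by_contra! hall
      apply (hne x).1
      simp [hitExt, hx, hitSum, hall]
    refine ENNReal.tsum_lt_tsum (i := n) (ne_top_of_le_ne_top hfin (ENNReal.tsum_le_tsum hterm))
      hterm ?_
    have hne' : ρ⁻¹ ^ n * hit q a n x ≠ ∞ := fun htop => by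
      refine hfin (ENNReal.tsum_eq_top_of_eq_top ⟨n, ?_⟩)
      rw [mul_assoc, htop, ENNReal.mul_top (lt_of_lt_of_le one_pos (hw1 _)).ne']
    simp only [hc, mul_assoc]
    exact (ENNReal.mul_lt_mul_iff_left (mul_ne_zero (pow_ne_zero _ hR0) hn) hne').2 (hwlt n)
  · calc transOp q (hitExt q a c) x ≤ transOp q (fun x => 2 * h x) x := transOp_mono q hle x
      _ = 2 * transOp q h x := by rw [transOp_const_mul]
      _ ≤ 2 * (ρ * h x) := by gcongr; exact hρ.transOp_hitExt_inv_le h0 h1 a x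
      _ ≤ 2 * ρ * hitExt q a c x := by rw [mul_assoc]; gcongr; exact hge x

/-- On a finite set the pointwise strict inequality becomes uniform by maximizing `q f / f`. -/
lemma exists_strict_super_finite [Nontrivial S] (hρ : IsSpecRad q ρ) (hq : Irred q) (h1 : ρ ≠ ∞)
    {F : Set S} (hF : F.Finite) {a : S} (ha : a ∉ F) :
    ∃ f : S → ℝ≥0∞, (∀ x, f x ≠ 0 ∧ f x ≠ ∞) ∧ (∀ x, x ≠ a → transOp q f x ≤ ρ * f x) ∧
      (∀ x, transOp q f x ≤ 2 * ρ * f x) ∧ ∃ σ < ρ, ∀ x ∈ F, transOp q f x ≤ σ * f x := by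
  obtain ⟨f, hf, hlt, hle⟩ := hρ.exists_strict_super hq h1 a
  refine ⟨f, hf, fun x hx => (hlt x hx).le, hle,
    hF.toFinset.sup (fun x => transOp q f x / f x), ?_, fun x hx => ?_⟩
  · rw [Finset.sup_lt_iff (bot_lt_iff_ne_bot.2 (hρ.ne_zero hq))]
    intro x hx
    rw [ENNReal.div_lt_iff (Or.inl (hf x).1) (Or.inl (hf x).2)]
    exact hlt x (by rintro rfl; simp at hx; exact ha hx)
  · rw [← ENNReal.div_le_iff (hf x).1 (hf x).2]
    exact Finset.le_sup (f := fun x => transOp q f x / f x) (by simpa using hx)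

/-- If the super-eigenvalue can be lowered strictly below `ρ` off a finite set, then it can be
lowered off any prescribed point. -/
lemma exists_super_off_point [Nontrivial S] (hρ : IsSpecRad q ρ) (hq : Irred q) (h1 : ρ ≠ ∞)
    {A : Set S} (hA : A.Finite) (a : S) {f : S → ℝ≥0∞} (hf : ∀ x, f x ≠ 0 ∧ f x ≠ ∞)
    {σ C : ℝ≥0∞} (hσ : σ < ρ) (hC : C ≠ ∞) (hoff : ∀ x, x ∉ A → transOp q f x ≤ σ * f x)
    (hall : ∀ x, transOp q f x ≤ C * f x) :
    ∃ g : S → ℝ≥0∞, (∀ x, g x ≠ 0 ∧ g x ≠ ∞) ∧ ∃ σ' < ρ, ∃ C' : ℝ≥0∞, C' ≠ ∞ ∧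
      (∀ x, x ≠ a → transOp q g x ≤ σ' * g x) ∧ ∀ x, transOp q g x ≤ C' * g x := by
  -- The strict slack of `h` on `A \ {a}` absorbs the crude bound `C` on `f`; off `A` the gain comes
  -- from `f`. At `a` a finite bound suffices.
  obtain ⟨h, hh, hle, hle2, σ₁, hσ₁, hlt⟩ :=
    hρ.exists_strict_super_finite hq h1 (hA.subset (Set.sdiff_subset (t := {a}))) (a := a) (by simp)
  obtain ⟨t, ht, ht0, ht1⟩ := ((eventually_geomMean_lt hσ₁ hC).and
    (Ioo_mem_nhdsGT (zero_lt_one (α := ℝ)))).exists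
  have h2 : 2 * ρ ≠ ∞ := ENNReal.mul_ne_top (by simp) h1
  refine ⟨fun y => h y ^ (1 - t) * f y ^ t, fun x => geomMean_ne (hh x) (hf x) t,
    max (ρ ^ (1 - t) * σ ^ t) (σ₁ ^ (1 - t) * C ^ t),
    max_lt (geomMean_lt h1 le_rfl hσ ht0 ht1.le) ht,
    (2 * ρ) ^ (1 - t) * C ^ t, ENNReal.mul_ne_top
      (ENNReal.rpow_ne_top_of_nonneg (by linarith) h2) (ENNReal.rpow_ne_top_of_nonneg ht0.le hC),
    fun x hx => ?_, fun x => transOp_geomMean_le_of_le ht0.le ht1.le (hle2 x) (hall x)⟩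
  by_cases hxA : x ∈ A
  · refine (transOp_geomMean_le_of_le ht0.le ht1.le (hlt x ⟨hxA, hx⟩) (hall x)).trans ?_
    gcongr
    exact le_max_right _ _
  · refine (transOp_geomMean_le_of_le ht0.le ht1.le (hle x hx) (hoff x hxA)).trans ?_
    gcongr
    exact le_max_left _ _

/-- If the super-eigenvalue can be lowered off the point `a`, then `U(a, a | 1 / ρ) ≥ 1`. -/
lemma one_le_inv_mul_hitSum [Nontrivial S] (hρ : IsSpecRad q ρ) (hq : Irred q) (h1 : ρ ≠ ∞)
    {a : S} {f : S → ℝ≥0∞} (hf : ∀ x, f x ≠ 0 ∧ f x ≠ ∞)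
    {σ C : ℝ≥0∞} (hσ : σ < ρ) (hC : C ≠ ∞) (hoff : ∀ x, x ≠ a → transOp q f x ≤ σ * f x)
    (hall : ∀ x, transOp q f x ≤ C * f x) :
    1 ≤ ρ⁻¹ * hitSum q a (fun n => ρ⁻¹ ^ n) a := by
  by_contra! hU
  have h0 := hρ.ne_zero hq
  set h := hitExt q a (fun n => ρ⁻¹ ^ n) with hh
  have hle := hρ.transOp_hitExt_inv_le h0 h1 a
  -- At `a` the ratio `q h / h` equals the hitting series, so `U < 1` is slack at the one point
  -- where `f` gives no gain.
  have ha : transOp q h a ≤ hitSum q a (fun n => ρ⁻¹ ^ n) a * h a := by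
    rw [hh, transOp_hitExt, hitExt_pow_self, mul_one]
  have hlt : hitSum q a (fun n => ρ⁻¹ ^ n) a < ρ := by
    rwa [mul_comm, ← div_eq_mul_inv, ENNReal.div_lt_iff (Or.inl h0) (Or.inl h1), one_mul] at hU
  obtain ⟨t, ht, ht0, ht1⟩ := ((eventually_geomMean_lt hlt hC).and
    (Ioo_mem_nhdsGT (zero_lt_one (α := ℝ)))).exists
  refine absurd (hρ.le_of_super (max (ρ ^ (1 - t) * σ ^ t)
    (hitSum q a (fun n => ρ⁻¹ ^ n) a ^ (1 - t) * C ^ t)) (fun y => h y ^ (1 - t) * f y ^ t)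
    (fun x => geomMean_ne (hρ.hitExt_inv_ne hq h0 h1 a x) (hf x) t) fun x => ?_)
    (not_le.2 (max_lt (geomMean_lt h1 le_rfl hσ ht0 ht1.le) ht))
  by_cases hx : x = a
  · subst hx
    refine (transOp_geomMean_le_of_le ht0.le ht1.le ha (hall x)).trans ?_
    gcongr
    exact le_max_right _ _
  · refine (transOp_geomMean_le_of_le ht0.le ht1.le (hle x) (hoff x hx)).trans ?_
    gcongr
    exact le_max_left _ _

-- `U ≥ 1` forces divergence on the diagonal; superharmonicity of the Green function spreads it to
-- all starting points.
open Classical in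
lemma green_eq_top [Nontrivial S] (hρ : IsSpecRad q ρ) (hq : Irred q) (h1 : ρ ≠ ∞)
    (hU : ∀ a, 1 ≤ ρ⁻¹ * hitSum q a (fun n => ρ⁻¹ ^ n) a) (x y : S) :
    neumann q ρ⁻¹ (Pi.single y 1) x = ∞ := by
  have h0 := hρ.ne_zero hq
  have hy : neumann q ρ⁻¹ (Pi.single y 1) y = ∞ := by
    by_contra hne
    exact absurd (mul_hitSum_lt_one_of_green_ne_top hne) (not_lt.2 (hU y))
  obtain ⟨n, hn⟩ := hq x y
  have h2 : ∀ x, transOp q (neumann q ρ⁻¹ (Pi.single y 1)) x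
      ≤ ρ * neumann q ρ⁻¹ (Pi.single y 1) x := fun x => by
    rw [mul_comm, ← ENNReal.div_le_iff h0 h1, div_eq_mul_inv, mul_comm]
    conv_rhs => rw [neumann_eq]
    exact le_add_self
  have h3 := (iterate_single_mul_le _ n x y).trans (iterate_le_of_le h2 n x)
  rw [hy, ENNReal.mul_top hn, top_le_iff] at h3
  by_contra hne
  exact ENNReal.mul_ne_top (ENNReal.pow_ne_top h1) hne h3

/-- A finite hitting series beyond `1 / ρ` lowers the super-eigenvalue off the point. -/
lemma exists_super_of_hitSum_ne_top (hq : Irred q) {z : ℝ≥0∞} (hz0 : z ≠ 0) (hz1 : z ≠ ∞) {a : S}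
    (h : hitSum q a (fun n => z ^ n) a ≠ ∞) :
    ∃ g : S → ℝ≥0∞, (∀ x, g x ≠ 0 ∧ g x ≠ ∞) ∧ ∃ C' : ℝ≥0∞, C' ≠ ∞ ∧
      (∀ x, x ≠ a → transOp q g x ≤ z⁻¹ * g x) ∧ ∀ x, transOp q g x ≤ C' * g x := by
  have hoff : ∀ x, x ≠ a → transOp q (hitExt q a (fun n => z ^ n)) x ≤
      z⁻¹ * hitExt q a (fun n => z ^ n) x := fun x hx => by
    rw [transOp_hitExt, hitExt_pow_of_ne z hx, ← mul_assoc, ENNReal.inv_mul_cancel hz0 hz1, one_mul]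
  have hC : max z⁻¹ (hitSum q a (fun n => z ^ n) a) ≠ ∞ := by
    simp [max_eq_top, hz0, h]
  have hall : ∀ x, transOp q (hitExt q a (fun n => z ^ n)) x ≤
      max z⁻¹ (hitSum q a (fun n => z ^ n) a) * hitExt q a (fun n => z ^ n) x := fun x => by
    by_cases hx : x = a
    · subst hx
      rw [transOp_hitExt, hitExt_pow_self, mul_one]
      exact le_max_right _ _
    · refine (hoff x hx).trans ?_
      gcongr
      exact le_max_left _ _
  exact ⟨_, pos_of_super hq hC hall (a := a) (by simp [hitExt]) (by simp [hitExt]), _, hC, hoff, hall⟩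

lemma hitSum_ne_top_of_super {a : S} {f : S → ℝ≥0∞} (hf : ∀ x, f x ≠ 0 ∧ f x ≠ ∞)
    {σ C : ℝ≥0∞} (hC : C ≠ ∞) (hoff : ∀ x, x ≠ a → transOp q f x ≤ σ * f x)
    (hall : ∀ x, transOp q f x ≤ C * f x) : hitSum q a (fun n => σ⁻¹ ^ n) a ≠ ∞ := by
  have h := mul_hitSum_le (q := q) (a := a) (z := σ⁻¹) (f := f) (fun x hx => by
    calc σ⁻¹ * transOp q f x ≤ σ⁻¹ * (σ * f x) := by gcongr; exact hoff x hx
      _ = (σ⁻¹ * σ) * f x := by ring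
      _ ≤ 1 * f x := by gcongr; exact ENNReal.inv_mul_le_one _
      _ = f x := one_mul _) a
  intro htop
  rw [htop, ENNReal.mul_top (hf a).1] at h
  exact ENNReal.mul_ne_top hC (hf a).2 (top_le_iff.1 (h.trans (hall a)))

end IsSpecRad

end Spec

/-! ### Convergence radii versus sums in `ℝ≥0∞`. -/

section PowerSeries

open FormalMultilinearSeries

lemma ennreal_tsum_ne_top_of_lt_radius {c : ℕ → ℝ≥0∞} (hc : ∀ n, c n ≠ ∞) {z : ℝ≥0∞}
    (h : z < (ofScalars ℝ (fun n => (c n).toReal)).radius) : ∑' n, c n * z ^ n ≠ ∞ := by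
  lift z to NNReal using h.ne_top
  lift c to ℕ → NNReal using hc
  have := summable_nnnorm_mul_pow _ h
  have e : ∀ n, ‖ofScalars ℝ (fun n => ((c n : ℝ≥0∞)).toReal) n‖₊ = c n := fun n => by
    ext
    rw [coe_nnnorm, ofScalars_norm]
    simp
  simp only [e] at this
  exact_mod_cast ENNReal.tsum_coe_ne_top_iff_summable.2 this

lemma le_radius_of_ennreal_tsum_ne_top {c : ℕ → ℝ≥0∞} (hc : ∀ n, c n ≠ ∞) {z : ℝ≥0∞} (hz : z ≠ ∞)
    (h : ∑' n, c n * z ^ n ≠ ∞) : z ≤ (ofScalars ℝ (fun n => (c n).toReal)).radius := by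
  lift z to NNReal using hz
  lift c to ℕ → NNReal using hc
  refine le_radius_of_summable_nnnorm _ ?_
  have e : ∀ n, ‖ofScalars ℝ (fun n => ((c n : ℝ≥0∞)).toReal) n‖₊ = c n := fun n => by
    ext
    rw [coe_nnnorm, ofScalars_norm]
    simp
  simp only [e]
  refine ENNReal.tsum_coe_ne_top_iff_summable.1 ?_
  exact_mod_cast h

end PowerSeries

/-! ### From trajectory laws to matrix powers. -/

namespace TransitionProb

variable {S : Type*}

/-- The transition matrix with entries in `ℝ≥0∞`. -/
def mat (P : TransitionProb S) (x y : S) : ℝ≥0∞ := ENNReal.ofReal (P.prob x y)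

lemma transOp_mat_one (P : TransitionProb S) (x : S) : transOp P.mat (fun _ => 1) x = 1 := by
  simp only [transOp, mul_one]
  exact (P.row x).tsum_coe

lemma returnTime_eq_succ_iff {a : S} {ω : ℕ → S} {n : ℕ} :
    returnTime a ω = ((n + 1 : ℕ) : ℕ∞) ↔ (∀ i < n, ω (i + 1) ≠ a) ∧ ω (n + 1) = a := by
  unfold returnTime
  constructor
  · intro h
    have hlow : ∀ m, 1 ≤ m → ω m = a → n + 1 ≤ m := fun m hm hma => by
      have : (⨅ (n : ℕ) (_ : 1 ≤ n ∧ ω n = a), (n : ℕ∞)) ≤ m := iInf₂_le m ⟨hm, hma⟩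
      rw [h] at this
      exact_mod_cast this
    refine ⟨fun i hi hia => by have := hlow (i + 1) (by omega) hia; omega, ?_⟩
    by_contra hne
    have : ((n + 2 : ℕ) : ℕ∞) ≤ ⨅ (n : ℕ) (_ : 1 ≤ n ∧ ω n = a), (n : ℕ∞) := by
      refine le_iInf₂ fun m hm => ?_
      have h1 := hlow m hm.1 hm.2
      have h2 : m ≠ n + 1 := by rintro rfl; exact hne hm.2
      exact_mod_cast (by omega : n + 2 ≤ m)
    rw [h] at this
    have : n + 2 ≤ n + 1 := by exact_mod_cast this
    omega
  · rintro ⟨h1, h2⟩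
    refine le_antisymm (iInf₂_le (n + 1) ⟨by omega, h2⟩) (le_iInf₂ fun m hm => ?_)
    have : n + 1 ≤ m := by
      by_contra hlt
      refine h1 (m - 1) (by have := hm.1; omega) ?_
      rw [Nat.sub_add_cancel hm.1]
      exact hm.2
    exact_mod_cast this

lemma returnTime_ne_zero (a : S) (ω : ℕ → S) : returnTime a ω ≠ ((0 : ℕ) : ℕ∞) := by
  have : ((1 : ℕ) : ℕ∞) ≤ returnTime a ω := le_iInf₂ fun m hm => by exact_mod_cast hm.1
  intro h
  rw [h] at this
  have : 1 ≤ 0 := by exact_mod_cast this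
  omega

variable [Countable S] [MeasurableSpace S] [DiscreteMeasurableSpace S]

lemma lintegral_kernel (P : TransitionProb S) (x : S) (f : S → ℝ≥0∞) :
    ∫⁻ y, f y ∂P.kernel x = transOp P.mat f x := by
  rw [lintegral_countable']
  refine tsum_congr fun y => ?_
  rw [mul_comm]
  congr 1
  change (P.row x).toMeasure {y} = _
  rw [PMF.toMeasure_apply_singleton _ _ (measurableSet_singleton y)]
  rfl

instance (P : TransitionProb S) (x : S) : IsProbabilityMeasure (P.chainLaw x) := by
  unfold chainLaw
  infer_instance

/-- The Markov property at time `n`. -/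
lemma lintegral_chainLaw_succ (P : TransitionProb S) (x : S) (n : ℕ)
    {g : ((i : Finset.Iic n) → S) → ℝ≥0∞} (hg : Measurable g) (f : S → ℝ≥0∞) :
    ∫⁻ ω, g (Preorder.frestrictLe n ω) * f (ω (n + 1)) ∂P.chainLaw x =
      ∫⁻ ω, g (Preorder.frestrictLe n ω) * transOp P.mat f (ω n) ∂P.chainLaw x := by
  have hf : Measurable f := Measurable.of_discrete
  have key := Kernel.partialTraj_compProd_eq_map_traj (X := fun _ => S) (κ := P.stepKernel)
    (zero_le (a := n)) (x₀ := fun _ => x)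
  have hmap := Kernel.traj_map_frestrictLe_apply (X := fun _ => S) (κ := P.stepKernel) 0 n
    (fun _ => x)
  have hm : Measurable (fun p : ((i : Finset.Iic n) → S) × S => g p.1 * f p.2) :=
    (hg.comp measurable_fst).mul (hf.comp measurable_snd)
  calc ∫⁻ ω, g (Preorder.frestrictLe n ω) * f (ω (n + 1)) ∂P.chainLaw x
      = ∫⁻ p, g p.1 * f p.2 ∂((P.chainLaw x).map
          (fun ω => (Preorder.frestrictLe n ω, ω (n + 1)))) := by
        rw [lintegral_map hm (by fun_prop)]
    _ = ∫⁻ h, ∫⁻ y, g h * f y ∂P.stepKernel n h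
          ∂(Kernel.partialTraj (X := fun _ => S) P.stepKernel 0 n (fun _ => x)) := by
        unfold chainLaw
        rw [← key, Measure.lintegral_compProd hm]
    _ = ∫⁻ h, g h * transOp P.mat f (h ⟨n, Finset.mem_Iic.2 le_rfl⟩)
          ∂(Kernel.partialTraj (X := fun _ => S) P.stepKernel 0 n (fun _ => x)) := by
        refine lintegral_congr fun h => ?_
        rw [lintegral_const_mul _ hf]
        congr 1
        exact P.lintegral_kernel _ f
    _ = _ := by
        have hT : Measurable (transOp P.mat f) := Measurable.of_discrete
        rw [← hmap, lintegral_map (by fun_prop) (by fun_prop)]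
        rfl

lemma lintegral_chainLaw_zero (P : TransitionProb S) (x : S) (f : S → ℝ≥0∞) :
    ∫⁻ ω, f (ω 0) ∂P.chainLaw x = f x := by
  have hf : Measurable f := Measurable.of_discrete
  have hmap := Kernel.traj_map_frestrictLe_apply (X := fun _ => S) (κ := P.stepKernel) 0 0
    (fun _ => x)
  have : ∫⁻ h, f (h ⟨0, Finset.mem_Iic.2 le_rfl⟩) ∂((P.chainLaw x).map (Preorder.frestrictLe 0))
      = f x := by
    unfold chainLaw
    rw [hmap, Kernel.partialTraj_self, Kernel.id_apply, lintegral_dirac' _ (by fun_prop)]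
  rw [lintegral_map (by fun_prop) (by fun_prop)] at this
  exact this

/-- Feynman–Kac form of the Markov property: the chain weighted by the product of `v` along the
times `1, …, n`. -/
lemma lintegral_chainLaw_prod (P : TransitionProb S) (x : S) (v : S → ℝ≥0∞) (n : ℕ)
    (f : S → ℝ≥0∞) :
    ∫⁻ ω, (∏ i ∈ Finset.range n, v (ω (i + 1))) * f (ω n) ∂P.chainLaw x =
      (transOp (fun x y => P.mat x y * v y))^[n] f x := by
  induction n generalizing f with
  | zero => simpa using P.lintegral_chainLaw_zero x f
  | succ n ih =>
    have hv : Measurable v := Measurable.of_discrete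
    have hm : Measurable (fun h : (i : Finset.Iic n) → S => ∏ i : Fin n,
        v (h ⟨i + 1, Finset.mem_Iic.2 i.2⟩)) :=
      Finset.measurable_prod _ fun i _ => by fun_prop
    -- Integrating out the last coordinate replaces `f` by its image under the weighted operator,
    -- hence the induction over all `f`.
    have h := P.lintegral_chainLaw_succ x n hm (fun y => v y * f y)
    have e : ∀ ω : ℕ → S, ∏ i : Fin n, v (Preorder.frestrictLe (π := fun _ => S) n ω
        ⟨i + 1, Finset.mem_Iic.2 i.2⟩) = ∏ i ∈ Finset.range n, v (ω (i + 1)) := fun ω => by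
      rw [← Fin.prod_univ_eq_prod_range (fun i => v (ω (i + 1)))]
      rfl
    simp only [e] at h
    rw [Function.iterate_succ_apply, ← ih]
    simp only [Finset.prod_range_succ, mul_assoc]
    rw [h]
    simp only [transOp, mul_assoc]

open Classical in
lemma chainLaw_eq (P : TransitionProb S) (x y : S) (n : ℕ) :
    P.chainLaw x {ω | ω n = y} = (transOp P.mat)^[n] (Pi.single y 1) x := by
  have h := P.lintegral_chainLaw_prod x (fun _ => 1) n (Pi.single y 1)
  simp only [Finset.prod_const_one, one_mul, mul_one] at h
  change _ = (transOp (fun x y => P.mat x y))^[n] (Pi.single y 1) x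
  rw [← h]
  have hm : MeasurableSet {ω : ℕ → S | ω n = y} :=
    measurableSet_eq_fun (measurable_pi_apply n) measurable_const
  rw [← lintegral_indicator_one hm]
  refine lintegral_congr fun ω => ?_
  simp [Set.indicator_apply, Pi.single_apply]

/-- Feynman–Kac with the weight that kills visits to `a` at times `1, …, n`, followed by one jump
into `a`. -/
lemma chainLaw_returnTime_succ (P : TransitionProb S) (x a : S) (n : ℕ) :
    P.chainLaw x {ω | returnTime a ω = ((n + 1 : ℕ) : ℕ∞)} = hit P.mat a n x := by
  classical
  have h := P.lintegral_chainLaw_prod x (fun y => if y = a then 0 else 1) n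
    (transOp P.mat (Pi.single a 1))
  have hq : (fun x y => P.mat x y * if y = a then 0 else 1) = taboo P.mat a := by
    funext x y
    simp [taboo]
  have hb : transOp P.mat (Pi.single a 1) = fun x => P.mat x a := by
    funext x
    simp only [transOp]
    rw [tsum_eq_single a (fun y hy => by simp [hy])]
    simp
  have hv : Measurable (fun y : S => if y = a then (0 : ℝ≥0∞) else 1) := Measurable.of_discrete
  have hm : Measurable (fun h : (i : Finset.Iic n) → S => ∏ i : Fin n,
      (if h ⟨i + 1, Finset.mem_Iic.2 i.2⟩ = a then (0 : ℝ≥0∞) else 1)) :=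
    Finset.measurable_prod _ fun i _ => hv.comp (measurable_pi_apply _)
  have h' := P.lintegral_chainLaw_succ x n hm (Pi.single a 1)
  have e : ∀ ω : ℕ → S, ∏ i : Fin n, (if Preorder.frestrictLe (π := fun _ => S) n ω
      ⟨i + 1, Finset.mem_Iic.2 i.2⟩ = a then (0 : ℝ≥0∞) else 1) =
      ∏ i ∈ Finset.range n, (if ω (i + 1) = a then 0 else 1) := fun ω => by
    rw [← Fin.prod_univ_eq_prod_range (fun i => if ω (i + 1) = a then (0 : ℝ≥0∞) else 1)]
    rfl
  simp only [e] at h'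
  rw [hq] at h
  rw [hit, ← hb, ← h, ← h']
  have hms : MeasurableSet {ω : ℕ → S | returnTime a ω = ((n + 1 : ℕ) : ℕ∞)} := by
    simp only [returnTime_eq_succ_iff]
    measurability
  rw [← lintegral_indicator_one hms]
  refine lintegral_congr fun ω => ?_
  simp only [Set.indicator_apply, Set.mem_ofPred_eq, returnTime_eq_succ_iff, Pi.one_apply]
  by_cases h1 : ∀ i < n, ω (i + 1) ≠ a
  · rw [Finset.prod_eq_one (fun i hi => by simp [h1 i (Finset.mem_range.1 hi)])]
    simp only [and_iff_right h1, Pi.single_apply, one_mul]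
  · rw [if_neg (fun hh => h1 hh.1)]
    push Not at h1
    obtain ⟨i, hi, hia⟩ := h1
    rw [Finset.prod_eq_zero (Finset.mem_range.2 hi) (by simp [hia]), zero_mul]

open Classical in
lemma green_eq_neumann (P : TransitionProb S) (x y : S) (z : ℝ≥0∞) :
    P.green x y z = neumann P.mat z (Pi.single y 1) x :=
  tsum_congr fun n => by rw [chainLaw_eq, mul_comm]

lemma tsum_returnTime (P : TransitionProb S) (x a : S) (z : ℝ≥0∞) :
    ∑' n : ℕ, P.chainLaw x {ω | returnTime a ω = (n : ℕ∞)} * z ^ n =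
      z * hitSum P.mat a (fun n => z ^ n) x := by
  rw [tsum_eq_zero_add' ENNReal.summable, hitSum, ← ENNReal.tsum_mul_left]
  simp only [returnTime_ne_zero, Set.ofPred_false, measure_empty, zero_mul, zero_add]
  refine tsum_congr fun n => ?_
  rw [chainLaw_returnTime_succ]
  ring

lemma hitSum_ne_top_of_lt_returnRadius (P : TransitionProb S) {x a : S} {z : ℝ≥0∞} (hz : z ≠ 0)
    (h : z < P.returnRadius x a) : hitSum P.mat a (fun n => z ^ n) x ≠ ∞ := by
  have := ennreal_tsum_ne_top_of_lt_radius (fun n => measure_ne_top (P.chainLaw x) _) h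
  rw [tsum_returnTime] at this
  intro htop
  rw [htop, ENNReal.mul_top hz] at this
  exact this rfl

lemma le_returnRadius (P : TransitionProb S) {x a : S} {z : ℝ≥0∞} (hz : z ≠ ∞)
    (h : hitSum P.mat a (fun n => z ^ n) x ≠ ∞) : z ≤ P.returnRadius x a := by
  refine le_radius_of_ennreal_tsum_ne_top (fun n => measure_ne_top (P.chainLaw x) _) hz ?_
  rw [tsum_returnTime]
  exact ENNReal.mul_ne_top hz h

lemma irred_mat {P : TransitionProb S} (hP : P.IsIrreducible) : Irred P.mat := fun x y => by
  obtain ⟨n, hn⟩ := hP x y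
  exact ⟨n, by rw [← chainLaw_eq]; exact hn.ne'⟩

/-- Iterating `P f ≤ θ f` gives `ℙ^x(X_n = y) f(y) ≤ θ^n f(x)`, so every Green series has radius at
least `1/θ`. -/
lemma isSpecRad (P : TransitionProb S) : IsSpecRad P.mat P.spectralRadius where
  le_of_super θ f hf h := by
    classical
    refine iSup₂_le fun x y => ?_
    rw [ENNReal.inv_le_iff_inv_le]
    refine ENNReal.le_of_forall_nnreal_lt fun z hz => ?_
    have hzθ : (z : ℝ≥0∞) * θ ≤ 1 := by
      have := mul_le_mul_left hz.le θ
      exact this.trans (ENNReal.inv_mul_le_one _)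
    refine FormalMultilinearSeries.le_radius_of_bound _ (f x / f y).toReal fun n => ?_
    rw [FormalMultilinearSeries.ofScalars_norm, Real.norm_of_nonneg measureReal_nonneg]
    have hb : P.chainLaw x {ω | ω n = y} * (z : ℝ≥0∞) ^ n ≤ f x / f y := by
      rw [ENNReal.le_div_iff_mul_le (Or.inl (hf y).1) (Or.inl (hf y).2), chainLaw_eq]
      calc _ = (z : ℝ≥0∞) ^ n * ((transOp P.mat)^[n] (Pi.single y 1) x * f y) := by ring
        _ ≤ (z : ℝ≥0∞) ^ n * (θ ^ n * f x) := by
          refine mul_le_mul_right ?_ _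
          exact (iterate_single_mul_le f n x y).trans (iterate_le_of_le h n x)
        _ = (z * θ) ^ n * f x := by ring
        _ ≤ 1 * f x := by gcongr; exact pow_le_one₀ zero_le hzθ
        _ = f x := one_mul _
    have := ENNReal.toReal_mono (ENNReal.div_ne_top (hf x).2 (hf y).1) hb
    simpa [Measure.real] using this
  green_ne_top z hz a := by
    rw [← green_eq_neumann]
    refine ennreal_tsum_ne_top_of_lt_radius (fun n => measure_ne_top (P.chainLaw a) _)
      (hz.trans_le ?_)
    refine (ENNReal.inv_le_iff_inv_le).1 ?_
    exact le_iSup₂ (f := fun x y => (P.greenRadius x y)⁻¹) a a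

end TransitionProb

/-! ### The lazy chain. -/

namespace TransitionProb

variable {S : Type*}

section Lazy

variable {P : TransitionProb S} {L : Set S} {κ : ℝ} {h0 : 0 ≤ κ} {h1 : κ < 1}

lemma transOp_lazy_of_notMem {x : S} (hx : x ∉ L) (f : S → ℝ≥0∞) :
    transOp (P.lazy L κ h0 h1).mat f x = transOp P.mat f x := by
  simp [transOp, mat, lazy, hx]

lemma transOp_lazy_of_mem {x : S} (hx : x ∈ L) (f : S → ℝ≥0∞) :
    transOp (P.lazy L κ h0 h1).mat f x =
      ENNReal.ofReal κ * f x + ENNReal.ofReal (1 - κ) * transOp P.mat f x := by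
  classical
  have h1' : 0 ≤ 1 - κ := by linarith
  simp only [transOp, mat, lazy, hx, if_true]
  have e : ∀ y, ENNReal.ofReal (κ * (if y = x then 1 else 0) + (1 - κ) * P.prob x y) * f y =
      (if y = x then ENNReal.ofReal κ * f x else 0) +
        ENNReal.ofReal (1 - κ) * (ENNReal.ofReal (P.prob x y) * f y) := fun y => by
    rw [ENNReal.ofReal_add (by split_ifs <;> simp [h0]) (mul_nonneg h1' (P.nonneg x y)),
      ENNReal.ofReal_mul h1', add_mul, mul_assoc]
    congr 1
    split_ifs with h
    · simp [h]
    · simp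
  simp only [e]
  rw [ENNReal.tsum_add, ENNReal.tsum_mul_left, tsum_ite_eq]

lemma ofReal_add_ofReal_one_sub (h0 : 0 ≤ κ) (h1 : κ < 1) :
    ENNReal.ofReal κ + ENNReal.ofReal (1 - κ) = 1 := by
  rw [← ENNReal.ofReal_add h0 (by linarith)]
  simp

/-- The lazy operator dominates `(1 - κ)` times the original one. -/
lemma irred_lazy (hq : Irred P.mat) : Irred (P.lazy L κ h0 h1).mat := by
  classical
  have hk' : ENNReal.ofReal (1 - κ) ≠ 0 := by simpa using h1
  have hle : ∀ f x, ENNReal.ofReal (1 - κ) * transOp P.mat f x ≤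
      transOp (P.lazy L κ h0 h1).mat f x := fun f x => by
    by_cases hx : x ∈ L
    · rw [transOp_lazy_of_mem hx]
      exact le_add_self
    · rw [transOp_lazy_of_notMem hx]
      exact mul_le_of_le_one_left zero_le (by simpa using h0)
  have hpow : ∀ f n x, ENNReal.ofReal (1 - κ) ^ n * (transOp P.mat)^[n] f x ≤
      (transOp (P.lazy L κ h0 h1).mat)^[n] f x := fun f n => by
    induction n with
    | zero => simp
    | succ n ih =>
      intro x
      rw [Function.iterate_succ_apply', Function.iterate_succ_apply']
      refine le_trans ?_ (transOp_mono _ (a := fun x => ENNReal.ofReal (1 - κ) ^ n *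
        (transOp P.mat)^[n] f x) ih x)
      rw [transOp_const_mul, pow_succ, mul_assoc]
      exact mul_le_mul_right (hle _ x) _
  intro x y
  obtain ⟨n, hn⟩ := hq x y
  exact ⟨n, fun h => mul_ne_zero (pow_ne_zero n hk') hn
    (le_antisymm ((hpow _ n x).trans h.le) zero_le)⟩

lemma le_sub_div_mul_of_lazy {x : S} (hx : x ∈ L) {f : S → ℝ≥0∞} (hf : f x ≠ ∞) {θ : ℝ≥0∞}
    (h : transOp (P.lazy L κ h0 h1).mat f x ≤ θ * f x) :
    transOp P.mat f x ≤ (θ - ENNReal.ofReal κ) / ENNReal.ofReal (1 - κ) * f x := by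
  have hk' : ENNReal.ofReal (1 - κ) ≠ 0 := by simpa using h1
  rw [transOp_lazy_of_mem hx] at h
  have h2 : ENNReal.ofReal (1 - κ) * transOp P.mat f x ≤ (θ - ENNReal.ofReal κ) * f x := by
    rw [ENNReal.sub_mul (fun _ _ => hf)]
    exact ENNReal.le_sub_of_add_le_left (ENNReal.mul_ne_top ENNReal.ofReal_ne_top hf) h
  rw [ENNReal.mul_comm_div, ← mul_div_assoc, mul_comm]
  rwa [ENNReal.le_div_iff_mul_le (Or.inl hk') (Or.inl ENNReal.ofReal_ne_top), mul_comm,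
    mul_comm (f x)]

end Lazy

variable [Countable S] [MeasurableSpace S] [DiscreteMeasurableSpace S]

/-! ### Comparing spectral radii; strict rho-recurrence. -/

section SpectralRadius

variable {P : TransitionProb S} {L : Set S} {κ : ℝ}

lemma spectralRadius_le_one (P : TransitionProb S) : P.spectralRadius ≤ 1 :=
  P.isSpecRad.le_of_super 1 (fun _ => 1) (by simp) fun x => by rw [transOp_mat_one]; simp

lemma spectralRadius_ne_top (P : TransitionProb S) : P.spectralRadius ≠ ∞ :=
  ne_top_of_le_ne_top ENNReal.one_ne_top P.spectralRadius_le_one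

/-- The slack available outside `L`: a proper convex combination of `1` and `ρ` exceeds `ρ` because
`ρ < 1`. -/
lemma spectralRadius_lt_lazy_bound (h0 : 0 < κ) (h1 : κ < 1) (hρ : P.spectralRadius < 1) :
    P.spectralRadius < ENNReal.ofReal κ + ENNReal.ofReal (1 - κ) * P.spectralRadius := by
  have hk : ENNReal.ofReal κ ≠ 0 := by simpa using h0
  calc P.spectralRadius
      = ENNReal.ofReal κ * P.spectralRadius + ENNReal.ofReal (1 - κ) * P.spectralRadius := by
        rw [← add_mul, ofReal_add_ofReal_one_sub h0.le h1, one_mul]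
    _ < ENNReal.ofReal κ * 1 + ENNReal.ofReal (1 - κ) * P.spectralRadius := by
        refine ENNReal.add_lt_add_right
          (ENNReal.mul_ne_top ENNReal.ofReal_ne_top P.spectralRadius_ne_top) ?_
        exact (ENNReal.mul_lt_mul_iff_right hk ENNReal.ofReal_ne_top).2 hρ
    _ = _ := by rw [mul_one]

lemma sub_div_lt {θ ρ : ℝ≥0∞} (hρ0 : ρ ≠ 0) (h1 : κ < 1)
    (h : θ < ENNReal.ofReal κ + ENNReal.ofReal (1 - κ) * ρ) :
    (θ - ENNReal.ofReal κ) / ENNReal.ofReal (1 - κ) < ρ := by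
  have hk' : ENNReal.ofReal (1 - κ) ≠ 0 := by simpa using h1
  rw [ENNReal.div_lt_iff (Or.inl hk') (Or.inl ENNReal.ofReal_ne_top), mul_comm]
  -- For `θ ≤ κ` the truncated subtraction is `0`, and `ρ ≠ 0` suffices.
  rcases le_or_gt θ (ENNReal.ofReal κ) with hle | hlt
  · rw [tsub_eq_zero_of_le hle]
    exact (mul_ne_zero hk' hρ0).bot_lt
  · exact ENNReal.sub_lt_of_lt_add hlt.le (by rwa [add_comm])

variable [Nontrivial S]

/-- `ρ^S_κ = κ + (1 - κ) ρ`. -/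
lemma spectralRadius_lazy_univ (h0 : 0 < κ) (h1 : κ < 1) (hP : P.IsIrreducible) :
    (P.lazy Set.univ κ h0.le h1).spectralRadius =
      ENNReal.ofReal κ + ENNReal.ofReal (1 - κ) * P.spectralRadius := by
  have hq := irred_mat hP
  refine le_antisymm ?_ ?_
  · obtain ⟨f, hf, hle⟩ := P.isSpecRad.exists_super hq P.spectralRadius_ne_top
    refine (isSpecRad _).le_of_super _ f hf fun x => ?_
    rw [transOp_lazy_of_mem (Set.mem_univ x), add_mul, mul_assoc]
    gcongr
    exact hle x
  · by_contra! hlt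
    obtain ⟨f, hf, hle⟩ := (P.lazy Set.univ κ h0.le h1).isSpecRad.exists_super
      (irred_lazy hq) (spectralRadius_ne_top _)
    exact absurd (P.isSpecRad.le_of_super _ f hf fun x =>
      le_sub_div_mul_of_lazy (Set.mem_univ x) (hf x).2 (hle x))
      (not_le.2 (sub_div_lt (P.isSpecRad.ne_zero hq) h1 hlt))

lemma spectralRadius_lazy_le (h0 : 0 < κ) (h1 : κ < 1) (hP : P.IsIrreducible) (hρ : P.spectralRadius < 1) :
    (P.lazy L κ h0.le h1).spectralRadius ≤
      ENNReal.ofReal κ + ENNReal.ofReal (1 - κ) * P.spectralRadius := by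
  obtain ⟨f, hf, hle⟩ := P.isSpecRad.exists_super (irred_mat hP) P.spectralRadius_ne_top
  refine (isSpecRad _).le_of_super _ f hf fun x => ?_
  by_cases hx : x ∈ L
  · rw [transOp_lazy_of_mem hx, add_mul, mul_assoc]
    gcongr
    exact hle x
  · rw [transOp_lazy_of_notMem hx]
    refine (hle x).trans ?_
    gcongr
    exact (spectralRadius_lt_lazy_bound h0 h1 hρ).le

/-- If the super-eigenvalue can be lowered below `ρ` on `L`, then `ρ^L_κ < κ + (1 - κ) ρ`. -/
lemma spectralRadius_lazy_lt (h0 : 0 < κ) (h1 : κ < 1) (hP : P.IsIrreducible) (hρ : P.spectralRadius < 1)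
    {f : S → ℝ≥0∞} (hf : ∀ x, f x ≠ 0 ∧ f x ≠ ∞) {σ C : ℝ≥0∞} (hσ : σ < P.spectralRadius)
    (hC : C ≠ ∞) (hon : ∀ x ∈ L, transOp P.mat f x ≤ σ * f x)
    (hall : ∀ x, transOp P.mat f x ≤ C * f x) :
    (P.lazy L κ h0.le h1).spectralRadius <
      ENNReal.ofReal κ + ENNReal.ofReal (1 - κ) * P.spectralRadius := by
  have hρt := P.spectralRadius_ne_top
  have hk' : ENNReal.ofReal (1 - κ) ≠ 0 := by simpa using h1
  obtain ⟨h, hh, hle⟩ := P.isSpecRad.exists_super (irred_mat hP) hρt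
  -- Only the cost outside `L` restricts `t`; on `L` every `t` in `(0, 1)` improves `ρ`.
  obtain ⟨t, ht, ht0, ht1⟩ := ((eventually_geomMean_lt
    (spectralRadius_lt_lazy_bound h0 h1 hρ) hC).and
    (Ioo_mem_nhdsGT (zero_lt_one (α := ℝ)))).exists
  set τ := P.spectralRadius ^ (1 - t) * σ ^ t
  have hτ : τ < P.spectralRadius := geomMean_lt hρt le_rfl hσ ht0 ht1.le
  refine lt_of_le_of_lt ((isSpecRad _).le_of_super
    (max (ENNReal.ofReal κ + ENNReal.ofReal (1 - κ) * τ) (P.spectralRadius ^ (1 - t) * C ^ t))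
    (fun y => h y ^ (1 - t) * f y ^ t) (fun x => geomMean_ne (hh x) (hf x) t) fun x => ?_)
    (max_lt ?_ ht)
  · by_cases hx : x ∈ L
    · rw [transOp_lazy_of_mem hx]
      calc _ ≤ ENNReal.ofReal κ * (h x ^ (1 - t) * f x ^ t) +
            ENNReal.ofReal (1 - κ) * (τ * (h x ^ (1 - t) * f x ^ t)) := by
            gcongr
            exact transOp_geomMean_le_of_le ht0.le ht1.le (hle x) (hon x hx)
        _ = (ENNReal.ofReal κ + ENNReal.ofReal (1 - κ) * τ) * (h x ^ (1 - t) * f x ^ t) := by ring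
        _ ≤ _ := by gcongr; exact le_max_left _ _
    · rw [transOp_lazy_of_notMem hx]
      refine (transOp_geomMean_le_of_le ht0.le ht1.le (hle x) (hall x)).trans ?_
      gcongr
      exact le_max_right _ _
  · exact ENNReal.add_lt_add_left ENNReal.ofReal_ne_top
      ((ENNReal.mul_lt_mul_iff_right hk' ENNReal.ofReal_ne_top).2 hτ)

/-- For strictly rho-recurrent `P` the super-eigenvalue can be lowered below `ρ` off any point. -/
lemma IsStrictlyRhoRecurrent.exists_super_off_point (hP : P.IsIrreducible)
    (hs : P.IsStrictlyRhoRecurrent) (a : S) :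
    ∃ g : S → ℝ≥0∞, (∀ x, g x ≠ 0 ∧ g x ≠ ∞) ∧ ∃ σ < P.spectralRadius, ∃ C : ℝ≥0∞, C ≠ ∞ ∧
      (∀ x, x ≠ a → transOp P.mat g x ≤ σ * g x) ∧ ∀ x, transOp P.mat g x ≤ C * g x := by
  have hq := irred_mat hP
  have hρ := P.isSpecRad
  have hρ0 := hρ.ne_zero hq
  have hρt := P.spectralRadius_ne_top
  have hR0 : P.spectralRadius⁻¹ ≠ 0 := by simpa using hρt
  have hR1 : P.spectralRadius⁻¹ ≠ ∞ := by simpa using hρ0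
  obtain ⟨b, hb⟩ := not_forall.1 hs.2
  -- As `U(b, b | 1/ρ) ≤ 1`, a radius different from `1/ρ` must be larger.
  have hge : P.spectralRadius⁻¹ ≤ P.returnRadius b b := by
    refine P.le_returnRadius hR1 fun htop => ?_
    have := hρ.inv_mul_hitSum_le_one hρ0 hρt b
    rw [htop, ENNReal.mul_top hR0] at this
    simp at this
  obtain ⟨z, hz1, hz2⟩ := exists_between (lt_of_le_of_ne hge (Ne.symm hb))
  have hz0 : z ≠ 0 := (pos_of_gt hz1).ne'
  obtain ⟨g, hg, C, hC, hoff, hall⟩ := IsSpecRad.exists_super_of_hitSum_ne_top hq hz0 hz2.ne_top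
    (P.hitSum_ne_top_of_lt_returnRadius hz0 hz2)
  exact hρ.exists_super_off_point hq hρt (Set.finite_singleton b) a hg
    (ENNReal.inv_lt_iff_inv_lt.1 hz1) hC (fun x hx => hoff x hx) hall

/-- If the super-eigenvalue can be lowered below `ρ` off a finite set, then `P` is strictly
rho-recurrent. -/
lemma isStrictlyRhoRecurrent_of_super (hP : P.IsIrreducible) {A : Set S} (hA : A.Finite)
    {f : S → ℝ≥0∞} (hf : ∀ x, f x ≠ 0 ∧ f x ≠ ∞) {σ C : ℝ≥0∞} (hσ : σ < P.spectralRadius)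
    (hC : C ≠ ∞) (hoff : ∀ x, x ∉ A → transOp P.mat f x ≤ σ * f x)
    (hall : ∀ x, transOp P.mat f x ≤ C * f x) : P.IsStrictlyRhoRecurrent := by
  have hq := irred_mat hP
  have hρ := P.isSpecRad
  have hρt := P.spectralRadius_ne_top
  have hpt := fun a => hρ.exists_super_off_point hq hρt hA a hf hσ hC hoff hall
  constructor
  · intro x y
    rw [green_eq_neumann]
    refine hρ.green_eq_top hq hρt (fun a => ?_) x y
    obtain ⟨g, hg, σ', hσ', C', hC', hoff', hall'⟩ := hpt a
    exact hρ.one_le_inv_mul_hitSum hq hρt hg hσ' hC' hoff' hall'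
  · intro hall2
    obtain ⟨a⟩ : Nonempty S := inferInstance
    obtain ⟨g, hg, σ', hσ', C', hC', hoff', hall'⟩ := hpt a
    -- `σ'` may be `0`; an intermediate `s` has a finite inverse still exceeding `1/ρ`.
    obtain ⟨s, hs1, hs2⟩ := exists_between hσ'
    have hs0 : s ≠ 0 := (pos_of_gt hs1).ne'
    have hfin : hitSum P.mat a (fun n => s⁻¹ ^ n) a ≠ ∞ :=
      IsSpecRad.hitSum_ne_top_of_super hg hC' (fun x hx => (hoff' x hx).trans
        (mul_le_mul_left hs1.le _)) hall'
    have := P.le_returnRadius (by simpa using hs0) hfin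
    rw [hall2 a, ENNReal.inv_le_inv] at this
    exact absurd this (not_le.2 hs2)

end SpectralRadius

end TransitionProb

end

open TransitionProb

theorem theorem1p4 {S : Type*} [Countable S] [Infinite S]
    [MeasurableSpace S] [DiscreteMeasurableSpace S]
    (P : TransitionProb S) (hP : P.IsIrreducible) (hρ : P.spectralRadius < 1)
    (L : Set S) (hL : Lᶜ.Nonempty) (κ : ℝ) (h0 : 0 < κ) (h1 : κ < 1) :
    (Lᶜ.Finite →
      ((P.lazy L κ h0.le h1).spectralRadius = (P.lazy Set.univ κ h0.le h1).spectralRadius ↔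
        ¬ P.IsStrictlyRhoRecurrent)) ∧
    (P.IsStrictlyRhoRecurrent →
      (P.lazy L κ h0.le h1).spectralRadius < (P.lazy Set.univ κ h0.le h1).spectralRadius) ∧
    (L.Finite →
      (P.lazy L κ h0.le h1).spectralRadius < (P.lazy Set.univ κ h0.le h1).spectralRadius) := by
  have hq := irred_mat hP
  have hρt := P.spectralRadius_ne_top
  obtain ⟨a, ha⟩ := hL
  rw [spectralRadius_lazy_univ h0 h1 hP]
  have hstrict : P.IsStrictlyRhoRecurrent → (P.lazy L κ h0.le h1).spectralRadius <
      ENNReal.ofReal κ + ENNReal.ofReal (1 - κ) * P.spectralRadius := fun hs => by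
    obtain ⟨g, hg, σ, hσ, C, hC, hoff, hall⟩ := hs.exists_super_off_point hP a
    exact spectralRadius_lazy_lt h0 h1 hP hρ hg hσ hC
      (fun x hx => hoff x (by rintro rfl; exact ha hx)) hall
  refine ⟨fun hfin => ⟨fun heq hs => (hstrict hs).ne heq, fun hns => ?_⟩, hstrict, fun hfin => ?_⟩
  · by_contra hne
    have hlt := lt_of_le_of_ne (spectralRadius_lazy_le (L := L) h0 h1 hP hρ) hne
    obtain ⟨f, hf, hle⟩ := (P.lazy L κ h0.le h1).isSpecRad.exists_super
      (irred_lazy hq) (spectralRadius_ne_top _)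
    -- Undoing the laziness on `L` turns a lazy eigenvalue below `κ + (1 - κ) ρ` into one below `ρ`
    -- for `P`.
    have hon : ∀ x ∈ L, _ := fun x hx => le_sub_div_mul_of_lazy hx (hf x).2 (hle x)
    have hσ := sub_div_lt (P.isSpecRad.ne_zero hq) h1 hlt
    refine hns (isStrictlyRhoRecurrent_of_super hP hfin hf hσ
      (C := max P.spectralRadius (P.lazy L κ h0.le h1).spectralRadius)
      (max_lt hρt.lt_top (spectralRadius_ne_top _).lt_top).ne
      (fun x hx => hon x (not_not.1 hx)) fun x => ?_)
    by_cases hx : x ∈ L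
    · refine (hon x hx).trans ?_
      gcongr
      exact hσ.le.trans (le_max_left _ _)
    · rw [← transOp_lazy_of_notMem (h0 := h0.le) (h1 := h1) hx]
      refine (hle x).trans ?_
      gcongr
      exact le_max_right _ _
  -- The exceptional point `a` lies outside `L`, so `f` beats `ρ` uniformly on the finite set `L`.
  · obtain ⟨f, hf, -, hall, σ, hσ, hon⟩ :=
      P.isSpecRad.exists_strict_super_finite hq hρt hfin ha
    exact spectralRadius_lazy_lt h0 h1 hP hρ hf hσ (ENNReal.mul_ne_top (by simp) hρt) hon hall
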